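/- Let $\oplus,\odot$ be the operations on $[0,1]$ given by $a\oplus b=\min\{a+b,1\}$ and $a\odot b=\max\{a+b-1,0\}$. An \emph{MC-algebra} is a set $A$ with binary operations $\lor,\land,\oplus,\odot$ and a constant $\lambda$ for each $\lambda\in[0,1]$, such that, for all $a,b,c\in A$, $\lambda\in[0,1]$ and $n,m\in\{0,1,2,\dots\}$: 1. $(A,\lor,\land,0,1)$ is a distributive bounded lattice (with order $\le$); 2. $(A,\oplus,0)$ and $(A,\odot,1)$ are commutative monoids, with $a\oplus 1=1$ and $a\odot 0=0$; 3. $\oplus$ and $\odot$ distribute over $\lor$ and over $\land$; 4. $(a\oplus b)\odot c\le a\oplus(b\odot c)$; 5. $a\le (a\odot(1-\lambda))\oplus\lambda$ and $(a\oplus\lambda)\odot(1-\lambda)\le a$; 6. $a\land\bigl(b\oplus \underbrace{(c\odot\lambda)\oplus\dots\oplus(c\odot\lambda)}_{n}\bigr)\le \bigl(a\odot\underbrace{(c\oplus\lambda)\odot\dots\odot(c\oplus\lambda)}_{m}\bigr)\lor b$; 7. for each operation $*\in\{\lor,\land,\oplus,\odot\}$ and all $\alpha,\beta,\gamma\in[0,1]$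 with $\alpha*\beta=\gamma$ in $[0,1]$, the corresponding constants satisfy $\alpha*\beta=\gamma$ in $A$. Morphisms of MC-algebras are the maps preserving $\lor,\land,\oplus,\odot$ and all the constants; $\mathbf{MC}$ denotes the resulting category. The interval $[0,1]$ is an MC-algebra. For $x,y$ in an MC-algebra $A$ put $$\operatorname{dist}^{\uparrow}(x,y)=\inf\{\lambda\in[0,1]\mid y\le x\oplus\lambda\},\qquad \operatorname{dist}(x,y)=\max\{\operatorname{dist}^{\uparrow}(x,y),\operatorname{dist}^{\uparrow}(y,x)\}.$$ $A$ is \emph{archimedean} if $\operatorname{dist}(x,y)=0$ implies $x=y$, and \emph{Cauchy complete} if every sequence that is Cauchy with respect to $\operatorname{dist}$ converges with respect to $\operatorname{dist}$ to some element of $A$. Let $\mathbf{PreT}$ be the category of topological spaces equipped with a preorder, with the monotone continuous maps, and let $\mathbf{PosComp}$ be its full subcategory of \emph{compact ordered spaces}: compact spaces $X$ with a partial order $\le$ such that $\{(x,y)\mid x\le y\}$ is closed in $X\times X$. For $X$ in $\mathbf{PreT}$, let $\mathrm{C}(X)=\hom_{\mathbf{PreT}}(X,[0,1])$, an MC-algebra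 with the pointwise operations. For $A$ in $\mathbf{MC}$, let $\mathrm{Max}(A)=\hom_{\mathbf{MC}}(A,[0,1])$, with the pointwise order and the smallest topology making all evaluations $x\mapsto x(a)$, $a\in A$, continuous. Precomposition makes $\mathrm{C}\colon\mathbf{PreT}\to\mathbf{MC}$ and $\mathrm{Max}\colon\mathbf{MC}\to\mathbf{PreT}$ contravariant functors. **Theorem.** If $X$ is a compact ordered space, then $\mathrm{C}(X)$ is archimedean and Cauchy complete; if $A$ is an archimedean Cauchy complete MC-algebra, then $\mathrm{Max}(A)$ is a compact ordered space. There is an equivalence of categories between $\mathbf{PosComp}^{\mathrm{op}}$ and the full subcategory of $\mathbf{MC}$ given by the archimedean Cauchy complete MC-algebras whose two functors are the restrictions of $\mathrm{C}$ and $\mathrm{Max}$. Moreover, for every compact ordered space $X$ the unit $\eta_X\colon X\to\mathrm{Max}(\mathrm{C}(X))$, $x\mapsto(a\mapsto a(x))$, is an isomorphism in $\mathbf{PreT}$, and for every archimedean Cauchy complete MC-algebra $A$ the unit $\varepsilon_A\colon A\to \mathrm{C}(\mathrm{Max}(A))$, $a\mapsto(x\mapsto x(a))$, is an isomorphism in $\mathbf{MC}$.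 -/

import Mathlib

open CategoryTheory Opposite

universe u v

namespace MCDuality

/-! ### MC-algebras -/

/-- The operations of MC-algebras other than the lattice operations: the binary operations
`⊕` and `⊙`, and a constant for each element of `[0,1]`. -/
class MCOps (A : Type u) where
  oplus : A → A → A
  odot : A → A → A
  const : unitInterval → A

/-- Truncated sum. -/
infixl:68 " ⊕ₘ " => MCOps.oplus

/-- Truncated product. -/
infixl:69 " ⊙ₘ " => MCOps.odot

open MCOps in
/-- The `n`-fold sum `x ⊕ ⋯ ⊕ x`; it is the constant `0` for `n = 0`. -/
def nOplus {A : Type u} [MCOps A] (x : A) : ℕ → A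
  | 0 => const 0
  | n + 1 => nOplus x n ⊕ₘ x

open MCOps in
/-- The `n`-fold product `x ⊙ ⋯ ⊙ x`; it is the constant `1` for `n = 0`. -/
def nOdot {A : Type u} [MCOps A] (x : A) : ℕ → A
  | 0 => const 1
  | n + 1 => nOdot x n ⊙ₘ x

/-- The operations on `[0,1]`: `a ⊕ b = min (a + b) 1`, `a ⊙ b = max (a + b - 1) 0`, and each
constant denotes itself. -/
noncomputable instance instMCOpsUnitInterval : MCOps unitInterval where
  oplus a b := ⟨min ((a : ℝ) + b) 1,
    le_min (add_nonneg a.2.1 b.2.1) zero_le_one, min_le_right _ _⟩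
  odot a b := ⟨max ((a : ℝ) + b - 1) 0, le_max_right _ _,
    max_le (by linarith [a.2.2, b.2.2]) zero_le_one⟩
  const l := l

open MCOps in
/-- MC-algebras. Here `unitInterval.symm l` is `1 - l`. -/
class MCAlgebra (A : Type u) extends DistribLattice A, BoundedOrder A, MCOps A where
  const_zero : const 0 = (⊥ : A)
  const_one : const 1 = (⊤ : A)
  oplus_assoc : ∀ a b c : A, (a ⊕ₘ b) ⊕ₘ c = a ⊕ₘ (b ⊕ₘ c)
  oplus_comm : ∀ a b : A, a ⊕ₘ b = b ⊕ₘ a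
  oplus_zero : ∀ a : A, a ⊕ₘ const 0 = a
  oplus_one : ∀ a : A, a ⊕ₘ const 1 = const 1
  odot_assoc : ∀ a b c : A, (a ⊙ₘ b) ⊙ₘ c = a ⊙ₘ (b ⊙ₘ c)
  odot_comm : ∀ a b : A, a ⊙ₘ b = b ⊙ₘ a
  odot_one : ∀ a : A, a ⊙ₘ const 1 = a
  odot_zero : ∀ a : A, a ⊙ₘ const 0 = const 0
  sup_oplus : ∀ a b c : A, (a ⊔ b) ⊕ₘ c = (a ⊕ₘ c) ⊔ (b ⊕ₘ c)
  inf_oplus : ∀ a b c : A, (a ⊓ b) ⊕ₘ c = (a ⊕ₘ c) ⊓ (b ⊕ₘ c)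
  sup_odot : ∀ a b c : A, (a ⊔ b) ⊙ₘ c = (a ⊙ₘ c) ⊔ (b ⊙ₘ c)
  inf_odot : ∀ a b c : A, (a ⊓ b) ⊙ₘ c = (a ⊙ₘ c) ⊓ (b ⊙ₘ c)
  oplus_odot_le : ∀ a b c : A, (a ⊕ₘ b) ⊙ₘ c ≤ a ⊕ₘ (b ⊙ₘ c)
  le_odot_oplus : ∀ (l : unitInterval) (a : A),
    a ≤ (a ⊙ₘ const (unitInterval.symm l)) ⊕ₘ const l
  oplus_odot_le_self : ∀ (l : unitInterval) (a : A),
    (a ⊕ₘ const l) ⊙ₘ const (unitInterval.symm l) ≤ a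
  inf_nOplus_le : ∀ (n m : ℕ) (l : unitInterval) (a b c : A),
    a ⊓ (b ⊕ₘ nOplus (c ⊙ₘ const l) n) ≤ (a ⊙ₘ nOdot (c ⊕ₘ const l) m) ⊔ b
  const_sup : ∀ α β : unitInterval, (const α ⊔ const β : A) = const (α ⊔ β)
  const_inf : ∀ α β : unitInterval, (const α ⊓ const β : A) = const (α ⊓ β)
  const_oplus : ∀ α β : unitInterval, (const α ⊕ₘ const β : A) = const (α ⊕ₘ β)
  const_odot : ∀ α β : unitInterval, (const α ⊙ₘ const β : A) = const (α ⊙ₘ β)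

attribute [instance 10] MCAlgebra.toDistribLattice MCAlgebra.toBoundedOrder

/-- Homomorphisms of MC-algebras. (`0` and `1` are among the constants.) -/
@[ext]
structure MCHom (A : Type u) (B : Type v) [MCAlgebra A] [MCAlgebra B] where
  toFun : A → B
  map_sup : ∀ a b, toFun (a ⊔ b) = toFun a ⊔ toFun b
  map_inf : ∀ a b, toFun (a ⊓ b) = toFun a ⊓ toFun b
  map_oplus : ∀ a b, toFun (a ⊕ₘ b) = toFun a ⊕ₘ toFun b
  map_odot : ∀ a b, toFun (a ⊙ₘ b) = toFun a ⊙ₘ toFun b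
  map_const : ∀ l : unitInterval, toFun (MCOps.const l) = MCOps.const l

instance instFunLikeMCHom {A : Type u} {B : Type v} [MCAlgebra A] [MCAlgebra B] :
    FunLike (MCHom A B) A B where
  coe := MCHom.toFun
  coe_injective _ _ h := MCHom.ext h

/-- The identity homomorphism. -/
def MCHom.id (A : Type u) [MCAlgebra A] : MCHom A A :=
  ⟨fun a => a, fun _ _ => rfl, fun _ _ => rfl, fun _ _ => rfl, fun _ _ => rfl, fun _ => rfl⟩

/-- Composition of homomorphisms: `g.comp f` is `g ∘ f`. -/
def MCHom.comp {A B : Type u} {C : Type v} [MCAlgebra A] [MCAlgebra B] [MCAlgebra C]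
    (g : MCHom B C) (f : MCHom A B) : MCHom A C where
  toFun a := g (f a)
  map_sup a b := (congrArg g (f.map_sup a b)).trans (g.map_sup _ _)
  map_inf a b := (congrArg g (f.map_inf a b)).trans (g.map_inf _ _)
  map_oplus a b := (congrArg g (f.map_oplus a b)).trans (g.map_oplus _ _)
  map_odot a b := (congrArg g (f.map_odot a b)).trans (g.map_odot _ _)
  map_const l := (congrArg g (f.map_const l)).trans (g.map_const l)

/-! ### The MC-algebra `[0,1]` -/

theorem coe_oplus (a b : unitInterval) : ((a ⊕ₘ b : unitInterval) : ℝ) = min ((a : ℝ) + b) 1 :=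
  rfl

theorem coe_odot (a b : unitInterval) :
    ((a ⊙ₘ b : unitInterval) : ℝ) = max ((a : ℝ) + b - 1) 0 := rfl

theorem const_eq (l : unitInterval) : (MCOps.const l : unitInterval) = l := rfl

theorem coe_sup_unitInterval (a b : unitInterval) :
    ((a ⊔ b : unitInterval) : ℝ) = max (a : ℝ) b := rfl

theorem coe_inf_unitInterval (a b : unitInterval) :
    ((a ⊓ b : unitInterval) : ℝ) = min (a : ℝ) b := rfl

theorem oplus_comm_unitInterval (a b : unitInterval) : a ⊕ₘ b = b ⊕ₘ a :=
  Subtype.ext (by rw [coe_oplus, coe_oplus, add_comm])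

theorem odot_comm_unitInterval (a b : unitInterval) : a ⊙ₘ b = b ⊙ₘ a :=
  Subtype.ext (by rw [coe_odot, coe_odot, add_comm])

theorem oplus_zero_unitInterval (a : unitInterval) : a ⊕ₘ (0 : unitInterval) = a :=
  Subtype.ext (by rw [coe_oplus, Set.Icc.coe_zero, add_zero, min_eq_left a.2.2])

theorem odot_one_unitInterval (a : unitInterval) : a ⊙ₘ (1 : unitInterval) = a :=
  Subtype.ext (by
    rw [coe_odot, Set.Icc.coe_one, add_sub_cancel_right, max_eq_left a.2.1])

theorem nOplus_zero_unitInterval (n : ℕ) : nOplus (0 : unitInterval) n = 0 := by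
  induction n with
  | zero => rfl
  | succ n ih => exact (oplus_zero_unitInterval _).trans ih

theorem nOdot_one_unitInterval (n : ℕ) : nOdot (1 : unitInterval) n = 1 := by
  induction n with
  | zero => rfl
  | succ n ih => exact (odot_one_unitInterval _).trans ih

theorem inf_nOplus_le_unitInterval (n m : ℕ) (l a b c : unitInterval) :
    a ⊓ (b ⊕ₘ nOplus (c ⊙ₘ l) n) ≤ (a ⊙ₘ nOdot (c ⊕ₘ l) m) ⊔ b := by
  rcases le_total ((c : ℝ) + l) 1 with h | h
  · have h0 : c ⊙ₘ l = 0 := Subtype.ext (by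
      rw [coe_odot, Set.Icc.coe_zero]; exact max_eq_right (by linarith))
    rw [h0, nOplus_zero_unitInterval, oplus_zero_unitInterval]
    exact inf_le_right.trans le_sup_right
  · have h1 : c ⊕ₘ l = 1 := Subtype.ext (by
      rw [coe_oplus, Set.Icc.coe_one]; exact min_eq_right h)
    rw [h1, nOdot_one_unitInterval, odot_one_unitInterval]
    exact inf_le_left.trans le_sup_left

noncomputable instance instMCAlgebraUnitInterval : MCAlgebra unitInterval where
  const_zero := rfl
  const_one := rfl
  oplus_assoc a b c := Subtype.ext (by
    simp only [coe_oplus]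
    have := a.2.1; have := c.2.1
    grind)
  oplus_comm := oplus_comm_unitInterval
  oplus_zero := oplus_zero_unitInterval
  oplus_one a := Subtype.ext (by
    rw [coe_oplus, const_eq, Set.Icc.coe_one]
    exact min_eq_right (by linarith [a.2.1]))
  odot_assoc a b c := Subtype.ext (by
    simp only [coe_odot]
    have := a.2.2; have := c.2.2
    grind)
  odot_comm := odot_comm_unitInterval
  odot_one := odot_one_unitInterval
  odot_zero a := Subtype.ext (by
    rw [coe_odot, const_eq, Set.Icc.coe_zero]
    exact max_eq_right (by linarith [a.2.2]))
  sup_oplus a b c := Subtype.ext (by simp only [coe_oplus, coe_sup_unitInterval]; grind)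
  inf_oplus a b c := Subtype.ext (by simp only [coe_oplus, coe_inf_unitInterval]; grind)
  sup_odot a b c := Subtype.ext (by
    simp only [coe_odot, coe_sup_unitInterval]; grind)
  inf_odot a b c := Subtype.ext (by
    simp only [coe_odot, coe_inf_unitInterval]; grind)
  oplus_odot_le a b c := Subtype.coe_le_coe.1 (by
    simp only [coe_odot, coe_oplus]
    have := a.2.1; have := a.2.2; have := b.2.1; have := b.2.2; have := c.2.1; have := c.2.2
    grind)
  le_odot_oplus l a := Subtype.coe_le_coe.1 (by
    simp only [coe_odot, coe_oplus, const_eq, unitInterval.coe_symm_eq]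
    have := a.2.1; have := a.2.2; have := l.2.1; have := l.2.2
    grind)
  oplus_odot_le_self l a := Subtype.coe_le_coe.1 (by
    simp only [coe_odot, coe_oplus, const_eq, unitInterval.coe_symm_eq]
    have := a.2.1; have := a.2.2; have := l.2.1; have := l.2.2
    grind)
  inf_nOplus_le := inf_nOplus_le_unitInterval
  const_sup _ _ := rfl
  const_inf _ _ := rfl
  const_oplus _ _ := rfl
  const_odot _ _ := rfl

theorem continuous_oplus_unitInterval :
    Continuous fun p : unitInterval × unitInterval => p.1 ⊕ₘ p.2 :=
  Continuous.subtype_mk (by fun_prop) _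

theorem continuous_odot_unitInterval :
    Continuous fun p : unitInterval × unitInterval => p.1 ⊙ₘ p.2 :=
  Continuous.subtype_mk (by fun_prop) _

theorem oplus_le_oplus_unitInterval {a b c d : unitInterval} (h : a ≤ b) (h' : c ≤ d) :
    a ⊕ₘ c ≤ b ⊕ₘ d :=
  Subtype.coe_le_coe.1 (min_le_min_right _
    (add_le_add (Subtype.coe_le_coe.2 h) (Subtype.coe_le_coe.2 h')))

theorem odot_le_odot_unitInterval {a b c d : unitInterval} (h : a ≤ b) (h' : c ≤ d) :
    a ⊙ₘ c ≤ b ⊙ₘ d :=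
  Subtype.coe_le_coe.1 (max_le_max_right _
    (sub_le_sub_right (add_le_add (Subtype.coe_le_coe.2 h) (Subtype.coe_le_coe.2 h')) 1))

/-! ### The distance, archimedean and Cauchy complete MC-algebras -/

/-- The infimum of the `l ∈ [0,1]` such that `y ≤ x ⊕ l`. -/
noncomputable def distUp {A : Type u} [MCAlgebra A] (x y : A) : ℝ :=
  sInf ((fun l : unitInterval => (l : ℝ)) '' {l | y ≤ x ⊕ₘ MCOps.const l})

/-- The distance of two elements of an MC-algebra. -/
noncomputable def mcDist {A : Type u} [MCAlgebra A] (x y : A) : ℝ :=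
  max (distUp x y) (distUp y x)

/-- An MC-algebra is archimedean if elements at distance `0` are equal. -/
def IsArchimedean (A : Type u) [MCAlgebra A] : Prop :=
  ∀ x y : A, mcDist x y = 0 → x = y

/-- Cauchy sequences in an MC-algebra. -/
def IsCauchySequence {A : Type u} [MCAlgebra A] (a : ℕ → A) : Prop :=
  ∀ ε : ℝ, 0 < ε → ∃ k, ∀ n m, k ≤ n → k ≤ m → mcDist (a n) (a m) < ε

/-- Convergence of a sequence in an MC-algebra. -/
def ConvergesTo {A : Type u} [MCAlgebra A] (a : ℕ → A) (b : A) : Prop :=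
  ∀ ε : ℝ, 0 < ε → ∃ n, ∀ m, n ≤ m → mcDist (a m) b < ε

/-- An MC-algebra is Cauchy complete if every Cauchy sequence converges. -/
def IsCauchyComplete (A : Type u) [MCAlgebra A] : Prop :=
  ∀ a : ℕ → A, IsCauchySequence a → ∃ b, ConvergesTo a b

/-! ### The categories -/

/-- Preordered topological spaces. -/
structure PreT : Type (u + 1) where
  carrier : Type u
  [top : TopologicalSpace carrier]
  [pre : Preorder carrier]

attribute [instance] PreT.top PreT.pre

instance instCoeSortPreT : CoeSort PreT.{u} (Type u) := ⟨PreT.carrier⟩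

/-- The morphisms of preordered topological spaces are the monotone continuous maps. -/
instance instCategoryPreT : Category PreT.{u} where
  Hom X Y := X →Co Y
  id X := ContinuousOrderHom.id X
  comp f g := ContinuousOrderHom.comp g f

/-- Compact ordered spaces: compact, with an antisymmetric preorder whose graph is closed. -/
def IsCompactOrdered : ObjectProperty PreT.{u} := fun X =>
  CompactSpace X ∧ (∀ x y : X, x ≤ y → y ≤ x → x = y) ∧ IsClosed {p : X × X | p.1 ≤ p.2}

/-- The category of compact ordered spaces and monotone continuous maps. -/
abbrev PosComp := (IsCompactOrdered.{u}).FullSubcategory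

/-- The objects of the category of MC-algebras. -/
structure MC : Type (u + 1) where
  carrier : Type u
  [alg : MCAlgebra carrier]

attribute [instance] MC.alg

instance instCoeSortMC : CoeSort MC.{u} (Type u) := ⟨MC.carrier⟩

instance instCategoryMC : Category MC.{u} where
  Hom A B := MCHom A B
  id A := MCHom.id A
  comp f g := MCHom.comp g f

/-- The property of being an archimedean and Cauchy complete MC-algebra. -/
def IsArchimedeanCauchyComplete : ObjectProperty MC.{u} := fun A =>
  IsArchimedean A ∧ IsCauchyComplete A

/-- The full subcategory of archimedean Cauchy complete MC-algebras. -/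
abbrev ArchimedeanCauchyCompleteMC := (IsArchimedeanCauchyComplete.{u}).FullSubcategory

/-! ### The functor `C = hom(-, [0,1])` -/

section CFunctor

variable {X : Type u} [TopologicalSpace X] [Preorder X]

noncomputable instance instMCOpsHom : MCOps (X →Co unitInterval) where
  oplus f g := ⟨⟨fun x => f x ⊕ₘ g x, fun _ _ h =>
    oplus_le_oplus_unitInterval (f.monotone' h) (g.monotone' h)⟩,
    continuous_oplus_unitInterval.comp (f.continuous_toFun.prodMk g.continuous_toFun)⟩
  odot f g := ⟨⟨fun x => f x ⊙ₘ g x, fun _ _ h =>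
    odot_le_odot_unitInterval (f.monotone' h) (g.monotone' h)⟩,
    continuous_odot_unitInterval.comp (f.continuous_toFun.prodMk g.continuous_toFun)⟩
  const l := ⟨⟨fun _ => l, fun _ _ _ => le_rfl⟩, continuous_const⟩

instance instMaxHom : Max (X →Co unitInterval) where
  max f g := ⟨⟨fun x => f x ⊔ g x, fun _ _ h =>
    sup_le_sup (f.monotone' h) (g.monotone' h)⟩, f.continuous_toFun.sup g.continuous_toFun⟩

instance instMinHom : Min (X →Co unitInterval) where
  min f g := ⟨⟨fun x => f x ⊓ g x, fun _ _ h =>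
    inf_le_inf (f.monotone' h) (g.monotone' h)⟩, f.continuous_toFun.inf g.continuous_toFun⟩

/-- The order on monotone continuous functions is the pointwise order. -/
noncomputable instance instDistribLatticeHom : DistribLattice (X →Co unitInterval) :=
  { DFunLike.coe_injective.distribLattice (fun f : X →Co unitInterval => (f : X → unitInterval))
      Iff.rfl Iff.rfl (fun _ _ => rfl) (fun _ _ => rfl) with }

instance instBoundedOrderHom : BoundedOrder (X →Co unitInterval) where
  top := ⟨⟨fun _ => 1, fun _ _ _ => le_rfl⟩, continuous_const⟩
  le_top _ _ := le_top
  bot := ⟨⟨fun _ => 0, fun _ _ _ => le_rfl⟩, continuous_const⟩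
  bot_le _ _ := bot_le

theorem nOplus_apply (f : X →Co unitInterval) (n : ℕ) (x : X) :
    nOplus f n x = nOplus (f x) n := by
  induction n with
  | zero => rfl
  | succ n ih => exact congrArg (· ⊕ₘ f x) ih

theorem nOdot_apply (f : X →Co unitInterval) (n : ℕ) (x : X) :
    nOdot f n x = nOdot (f x) n := by
  induction n with
  | zero => rfl
  | succ n ih => exact congrArg (· ⊙ₘ f x) ih

/-- The monotone continuous functions to `[0,1]` form an MC-algebra with the pointwise
operations. -/
noncomputable instance instMCAlgebraHom : MCAlgebra (X →Co unitInterval) where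
  const_zero := rfl
  const_one := rfl
  oplus_assoc f g h := DFunLike.ext _ _ fun x => MCAlgebra.oplus_assoc (f x) (g x) (h x)
  oplus_comm f g := DFunLike.ext _ _ fun x => MCAlgebra.oplus_comm (f x) (g x)
  oplus_zero f := DFunLike.ext _ _ fun x => MCAlgebra.oplus_zero (f x)
  oplus_one f := DFunLike.ext _ _ fun x => MCAlgebra.oplus_one (f x)
  odot_assoc f g h := DFunLike.ext _ _ fun x => MCAlgebra.odot_assoc (f x) (g x) (h x)
  odot_comm f g := DFunLike.ext _ _ fun x => MCAlgebra.odot_comm (f x) (g x)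
  odot_one f := DFunLike.ext _ _ fun x => MCAlgebra.odot_one (f x)
  odot_zero f := DFunLike.ext _ _ fun x => MCAlgebra.odot_zero (f x)
  sup_oplus f g h := DFunLike.ext _ _ fun x => MCAlgebra.sup_oplus (f x) (g x) (h x)
  inf_oplus f g h := DFunLike.ext _ _ fun x => MCAlgebra.inf_oplus (f x) (g x) (h x)
  sup_odot f g h := DFunLike.ext _ _ fun x => MCAlgebra.sup_odot (f x) (g x) (h x)
  inf_odot f g h := DFunLike.ext _ _ fun x => MCAlgebra.inf_odot (f x) (g x) (h x)
  oplus_odot_le f g h := fun x => MCAlgebra.oplus_odot_le (f x) (g x) (h x)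
  le_odot_oplus l f := fun x => MCAlgebra.le_odot_oplus l (f x)
  oplus_odot_le_self l f := fun x => MCAlgebra.oplus_odot_le_self l (f x)
  inf_nOplus_le n m l f g h := fun x => by
    change f x ⊓ (g x ⊕ₘ nOplus (h ⊙ₘ MCOps.const l) n x) ≤
      (f x ⊙ₘ nOdot (h ⊕ₘ MCOps.const l) m x) ⊔ g x
    rw [nOplus_apply, nOdot_apply]
    exact inf_nOplus_le_unitInterval n m l (f x) (g x) (h x)
  const_sup _ _ := rfl
  const_inf _ _ := rfl
  const_oplus _ _ := rfl
  const_odot _ _ := rfl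

end CFunctor

/-- The contravariant functor `X ↦ C(X) = hom(X, [0,1])`, `g ↦ (a ↦ a ∘ g)`. -/
noncomputable def C : PreT.{u}ᵒᵖ ⥤ MC.{u} where
  obj X := { carrier := X.unop →Co unitInterval }
  map {X Y} g :=
    { toFun := fun a : X.unop →Co unitInterval => ContinuousOrderHom.comp a g.unop
      map_sup := fun _ _ => rfl
      map_inf := fun _ _ => rfl
      map_oplus := fun _ _ => rfl
      map_odot := fun _ _ => rfl
      map_const := fun _ => rfl }

/-! ### The functor `Max = hom(-, [0,1])` -/

section MaxFunctor

variable {A : Type u} [MCAlgebra A]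

/-- The smallest topology for which all evaluations `x ↦ x a` are continuous. -/
noncomputable instance instTopologicalSpaceMax : TopologicalSpace (MCHom A unitInterval) :=
  ⨅ a : A, TopologicalSpace.induced (fun x : MCHom A unitInterval => x a) inferInstance

/-- The pointwise order. -/
instance instPreorderMax : Preorder (MCHom A unitInterval) where
  le x y := ∀ a : A, x a ≤ y a
  le_refl _ _ := le_rfl
  le_trans _ _ _ h h' a := (h a).trans (h' a)

theorem continuous_eval (a : A) : Continuous fun x : MCHom A unitInterval => x a :=
  continuous_iInf_dom continuous_induced_dom

end MaxFunctor

/-- The contravariant functor `A ↦ Max(A) = hom(A, [0,1])`, `f ↦ (x ↦ x ∘ f)`. -/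
noncomputable def Max : MC.{u}ᵒᵖ ⥤ PreT.{u} where
  obj A := { carrier := MCHom A.unop unitInterval }
  map {A B} f :=
    { toFun := fun x : MCHom A.unop unitInterval => MCHom.comp x f.unop
      monotone' := fun _ _ h b => h (f.unop.toFun b)
      continuous_toFun := continuous_iInf_rng.2 fun b =>
        continuous_induced_rng.2 (continuous_eval (A := A.unop) (f.unop.toFun b)) }

/-! ### The units -/

/-- Evaluation at a point `x`, as a homomorphism from `C(X)` to `[0,1]`. -/
def evalPoint {X : Type u} [TopologicalSpace X] [Preorder X] (x : X) :
    MCHom (X →Co unitInterval) unitInterval where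
  toFun a := a x
  map_sup _ _ := rfl
  map_inf _ _ := rfl
  map_oplus _ _ := rfl
  map_odot _ _ := rfl
  map_const _ := rfl

/-- Evaluation at an element `a`, as a monotone continuous map from `Max(A)` to `[0,1]`. -/
noncomputable def evalElement {A : Type u} [MCAlgebra A] (a : A) : MCHom A unitInterval →Co unitInterval where
  toFun x := x a
  monotone' _ _ h := h a
  continuous_toFun := continuous_eval a

/-- The unit `η_X : X ⟶ Max(C(X))`, sending `x` to the evaluation at `x`. -/
noncomputable def etaUnit (X : PreT.{u}) : X ⟶ Max.obj (op (C.obj (op X))) :=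
  ({ toFun := evalPoint
     monotone' := fun _ _ h a => a.monotone' h
     continuous_toFun := continuous_iInf_rng.2 fun a =>
       continuous_induced_rng.2 a.continuous_toFun } :
    X →Co MCHom (X →Co unitInterval) unitInterval)

/-- The unit `ε_A : A ⟶ C(Max(A))`, sending `a` to the evaluation at `a`. -/
noncomputable def epsilonUnit (A : MC.{u}) : A ⟶ C.obj (op (Max.obj (op A))) :=
  ({ toFun := evalElement
     map_sup := fun a b => DFunLike.ext _ _ fun x => x.map_sup a b
     map_inf := fun a b => DFunLike.ext _ _ fun x => x.map_inf a b
     map_oplus := fun a b => DFunLike.ext _ _ fun x => x.map_oplus a b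
     map_odot := fun a b => DFunLike.ext _ _ fun x => x.map_odot a b
     map_const := fun l => DFunLike.ext _ _ fun x => x.map_const l } :
    MCHom A (MCHom A unitInterval →Co unitInterval))

/-! ### The restricted functors -/

/-- The restriction of `C` to compact ordered spaces, with values in archimedean Cauchy complete
MC-algebras, given that it takes such values. -/
noncomputable def CRestrict
    (hC : ∀ X : PosComp.{u}, IsArchimedeanCauchyComplete (C.obj (op X.obj))) :
    PosComp.{u}ᵒᵖ ⥤ ArchimedeanCauchyCompleteMC.{u} :=
  IsArchimedeanCauchyComplete.lift (IsCompactOrdered.ι.op ⋙ C) fun X => hC X.unop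

/-- The restriction of `Max` to archimedean Cauchy complete MC-algebras, with values in compact
ordered spaces, given that it takes such values. -/
noncomputable def MaxRestrict
    (hM : ∀ A : ArchimedeanCauchyCompleteMC.{u}, IsCompactOrdered (Max.obj (op A.obj))) :
    ArchimedeanCauchyCompleteMC.{u}ᵒᵖ ⥤ PosComp.{u} :=
  IsCompactOrdered.lift (IsArchimedeanCauchyComplete.ι.op ⋙ Max) fun A => hM A.unop

end MCDuality

/-!
The duality rests on two facts about the homomorphisms from an MC-algebra `A` to `[0,1]`.

*There are enough of them.* Consider preorders on `A` that contain the order and are preserved by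
the operations. If `a ≰ b`, Zorn's lemma gives such a preorder `R`, maximal among those that omit
`(a, b)`. For an element `c` and a constant `l`, the preorders generated by `R` together with
`c ⊙ l ⊑ 0`, respectively `1 ⊑ c ⊕ l`, intersect in `R`: this is what the axiom on multiples and
powers says (`CompatiblePreorder.rel_of_collapse`). So one of the two omits `(a, b)` and equals `R`,
whence `R` compares `c` with `1 - l`. Since every element is comparable with every constant, it has
a value in `[0,1]`, the cut it makes in the constants, and taking values is a homomorphism `v`
with `v b ≤ v a` (`exists_hom_le_of_not_le`). Applied to `a ⊙ (1 - m)` and `b ⊕ m` in place of `a`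
and `b`, this gives a strict inequality, so the distance of `A` is the supremum distance of the
evaluations on `Max(A)` (`mcDist_le_of_forall`, `abs_apply_sub_apply_le`). In particular, evaluation
is injective on an archimedean algebra.

*They are separated by elements.* If `x ≰ y` in `Max(A)`, subtracting a constant and taking a
multiple yields `a` with `x a = 1` and `y a = 0`. The usual two compactness arguments, with finite
infima and then finite suprema, show that the evaluations are uniformly dense in `C(Max(A))`
(`exists_abs_apply_sub_lt`); if `A` is Cauchy complete they exhaust it.

For a compact ordered space `X`, the order is determined by `C(X)` because Urysohn's construction
yields monotone functions when all the open sets in it are lower sets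
(`exists_apply_lt_of_not_le`). A homomorphism `v : C(X) → [0,1]` is an evaluation since the sets
`{f = 0} ∩ {g = 1}` with `v f = 0` and `v g = 1` form a directed family of nonempty closed sets
(`evalPoint_surjective`). Hence both units are isomorphisms, and they are natural.
-/

namespace MCDuality

open MCOps

/-! ### Arithmetic in MC-algebras -/

section Arithmetic

variable {A : Type u} [MCAlgebra A]

theorem oplus_le_oplus {a b c d : A} (h : a ≤ b) (h' : c ≤ d) : a ⊕ₘ c ≤ b ⊕ₘ d := by
  have h₁ : ∀ {x y : A} (z : A), x ≤ y → x ⊕ₘ z ≤ y ⊕ₘ z := fun {x y} z hxy => by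
    rw [← sup_eq_right, ← MCAlgebra.sup_oplus, sup_eq_right.2 hxy]
  refine (h₁ c h).trans ?_
  rw [MCAlgebra.oplus_comm b c, MCAlgebra.oplus_comm b d]
  exact h₁ b h'

theorem odot_le_odot {a b c d : A} (h : a ≤ b) (h' : c ≤ d) : a ⊙ₘ c ≤ b ⊙ₘ d := by
  have h₁ : ∀ {x y : A} (z : A), x ≤ y → x ⊙ₘ z ≤ y ⊙ₘ z := fun {x y} z hxy => by
    rw [← sup_eq_right, ← MCAlgebra.sup_odot, sup_eq_right.2 hxy]
  refine (h₁ c h).trans ?_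
  rw [MCAlgebra.odot_comm b c, MCAlgebra.odot_comm b d]
  exact h₁ b h'

theorem le_oplus_left (a b : A) : a ≤ a ⊕ₘ b :=
  (MCAlgebra.oplus_zero a).ge.trans
    (oplus_le_oplus le_rfl (MCAlgebra.const_zero.trans_le bot_le))

theorem odot_le_left (a b : A) : a ⊙ₘ b ≤ a :=
  (odot_le_odot le_rfl (le_top.trans_eq MCAlgebra.const_one.symm)).trans_eq
    (MCAlgebra.odot_one a)

/-- Subtracting a constant is left adjoint to adding it. -/
theorem odot_const_symm_le_iff {a b : A} {l : unitInterval} :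
    a ⊙ₘ const (unitInterval.symm l) ≤ b ↔ a ≤ b ⊕ₘ const l :=
  ⟨fun h => (MCAlgebra.le_odot_oplus l a).trans (oplus_le_oplus h le_rfl),
    fun h => (odot_le_odot h le_rfl).trans (MCAlgebra.oplus_odot_le_self l b)⟩

theorem nOplus_add (a : A) (m n : ℕ) : nOplus a (m + n) = nOplus a m ⊕ₘ nOplus a n := by
  induction n with
  | zero => exact (MCAlgebra.oplus_zero _).symm
  | succ n ih =>
    change nOplus a (m + n) ⊕ₘ a = nOplus a m ⊕ₘ (nOplus a n ⊕ₘ a)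
    rw [ih, MCAlgebra.oplus_assoc]

theorem nOdot_add (a : A) (m n : ℕ) : nOdot a (m + n) = nOdot a m ⊙ₘ nOdot a n := by
  induction n with
  | zero => exact (MCAlgebra.odot_one _).symm
  | succ n ih =>
    change nOdot a (m + n) ⊙ₘ a = nOdot a m ⊙ₘ (nOdot a n ⊙ₘ a)
    rw [ih, MCAlgebra.odot_assoc]

theorem nOplus_one (a : A) : nOplus a 1 = a := by
  change const 0 ⊕ₘ a = a
  rw [MCAlgebra.oplus_comm, MCAlgebra.oplus_zero]

theorem nOdot_one (a : A) : nOdot a 1 = a := by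
  change const 1 ⊙ₘ a = a
  rw [MCAlgebra.odot_comm, MCAlgebra.odot_one]

theorem nOplus_const (l : unitInterval) (n : ℕ) : nOplus (const l : A) n = const (nOplus l n) := by
  induction n with
  | zero => rfl
  | succ n ih =>
    change nOplus (const l : A) n ⊕ₘ const l = const (nOplus l n ⊕ₘ l)
    rw [ih, MCAlgebra.const_oplus]

theorem oplus_oplus_oplus_comm (a b c d : A) :
    (a ⊕ₘ b) ⊕ₘ (c ⊕ₘ d) = (a ⊕ₘ c) ⊕ₘ (b ⊕ₘ d) := by
  rw [MCAlgebra.oplus_assoc, MCAlgebra.oplus_assoc, ← MCAlgebra.oplus_assoc b,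
    MCAlgebra.oplus_comm b c, MCAlgebra.oplus_assoc]

theorem odot_odot_odot_comm (a b c d : A) :
    (a ⊙ₘ b) ⊙ₘ (c ⊙ₘ d) = (a ⊙ₘ c) ⊙ₘ (b ⊙ₘ d) := by
  rw [MCAlgebra.odot_assoc, MCAlgebra.odot_assoc, ← MCAlgebra.odot_assoc b,
    MCAlgebra.odot_comm b c, MCAlgebra.odot_assoc]

theorem oplus_odot_oplus_le (a b s t : A) :
    (a ⊕ₘ s) ⊙ₘ (b ⊕ₘ t) ≤ (a ⊙ₘ b) ⊕ₘ (s ⊕ₘ t) := by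
  have h₁ : (a ⊕ₘ s) ⊙ₘ (b ⊕ₘ t) ≤ s ⊕ₘ (a ⊙ₘ (b ⊕ₘ t)) := by
    rw [MCAlgebra.oplus_comm a s]
    exact MCAlgebra.oplus_odot_le s a _
  have h₂ : a ⊙ₘ (b ⊕ₘ t) ≤ t ⊕ₘ (b ⊙ₘ a) := by
    rw [MCAlgebra.odot_comm a, MCAlgebra.oplus_comm b t]
    exact MCAlgebra.oplus_odot_le t b a
  refine (h₁.trans (oplus_le_oplus le_rfl h₂)).trans_eq ?_
  rw [← MCAlgebra.oplus_assoc, MCAlgebra.oplus_comm _ (b ⊙ₘ a), MCAlgebra.odot_comm b a]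

theorem oplus_odot_odot_le (a b s t : A) :
    (a ⊕ₘ b) ⊙ₘ (s ⊙ₘ t) ≤ (a ⊙ₘ s) ⊕ₘ (b ⊙ₘ t) := by
  have h₁ : (a ⊕ₘ b) ⊙ₘ s ≤ b ⊕ₘ (a ⊙ₘ s) := by
    rw [MCAlgebra.oplus_comm a b]
    exact MCAlgebra.oplus_odot_le b a s
  rw [← MCAlgebra.odot_assoc]
  refine (odot_le_odot h₁ le_rfl).trans ?_
  rw [MCAlgebra.oplus_comm b]
  exact MCAlgebra.oplus_odot_le _ b t

end Arithmetic

/-! ### Multiples in `[0,1]` -/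

theorem coe_nOplus (a : unitInterval) (n : ℕ) :
    ((nOplus a n : unitInterval) : ℝ) = min (n * (a : ℝ)) 1 := by
  induction n with
  | zero =>
    change (0 : ℝ) = _
    simp
  | succ n ih =>
    change min (((nOplus a n : unitInterval) : ℝ) + a) 1 = _
    have := a.2.1
    rw [ih]
    push_cast
    grind

theorem exists_nOplus_eq_one {a : unitInterval} (ha : 0 < a) : ∃ n, nOplus a n = 1 := by
  obtain ⟨n, hn⟩ := Archimedean.arch (1 : ℝ) (show (0 : ℝ) < a from ha)
  refine ⟨n, Subtype.ext ?_⟩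
  rw [coe_nOplus, Set.Icc.coe_one]
  exact min_eq_right (by simpa using hn)

/-! ### Compatible preorders -/

/-- A preorder on an MC-algebra that contains the order and is preserved by the operations.
Antisymmetrization turns these into the congruences together with their quotient orders. -/
structure CompatiblePreorder (A : Type u) [MCAlgebra A] where
  /-- The relation. -/
  rel : A → A → Prop
  of_le : ∀ {a b}, a ≤ b → rel a b
  trans : ∀ {a b c}, rel a b → rel b c → rel a c
  sup : ∀ {a b c d}, rel a b → rel c d → rel (a ⊔ c) (b ⊔ d)
  inf : ∀ {a b c d}, rel a b → rel c d → rel (a ⊓ c) (b ⊓ d)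
  oplus : ∀ {a b c d}, rel a b → rel c d → rel (a ⊕ₘ c) (b ⊕ₘ d)
  odot : ∀ {a b c d}, rel a b → rel c d → rel (a ⊙ₘ c) (b ⊙ₘ d)

namespace CompatiblePreorder

variable {A : Type u} [MCAlgebra A]

/-- Compatible preorders are ordered by inclusion. -/
instance : PartialOrder (CompatiblePreorder A) :=
  PartialOrder.lift rel fun R S h => by
    cases R; cases S; cases h; rfl

/-- The order of the algebra, as the least compatible preorder. -/
def ofLE (A : Type u) [MCAlgebra A] : CompatiblePreorder A where
  rel a b := a ≤ b
  of_le h := h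
  trans := le_trans
  sup := sup_le_sup
  inf := inf_le_inf
  oplus := oplus_le_oplus
  odot := odot_le_odot

/-- The union of a nonempty chain of compatible preorders. -/
def sUnion (c : Set (CompatiblePreorder A)) (hc : IsChain (· ≤ ·) c) (hne : c.Nonempty) :
    CompatiblePreorder A :=
  have join : ∀ {a b a' b' : A}, (∃ R ∈ c, R.rel a b) → (∃ R ∈ c, R.rel a' b') →
      ∃ R ∈ c, R.rel a b ∧ R.rel a' b' := by
    rintro a b a' b' ⟨R, hR, h⟩ ⟨S, hS, h'⟩
    rcases hc.total hR hS with hRS | hSR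
    · exact ⟨S, hS, hRS _ _ h, h'⟩
    · exact ⟨R, hR, h, hSR _ _ h'⟩
  { rel a b := ∃ R ∈ c, R.rel a b
    of_le h := hne.imp fun R hR => ⟨hR, R.of_le h⟩
    trans h h' := (join h h').imp fun R hR => ⟨hR.1, R.trans hR.2.1 hR.2.2⟩
    sup h h' := (join h h').imp fun R hR => ⟨hR.1, R.sup hR.2.1 hR.2.2⟩
    inf h h' := (join h h').imp fun R hR => ⟨hR.1, R.inf hR.2.1 hR.2.2⟩
    oplus h h' := (join h h').imp fun R hR => ⟨hR.1, R.oplus hR.2.1 hR.2.2⟩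
    odot h h' := (join h h').imp fun R hR => ⟨hR.1, R.odot hR.2.1 hR.2.2⟩ }

variable (R : CompatiblePreorder A)

theorem refl (a : A) : R.rel a a := R.of_le le_rfl

theorem rel_of_le_of_rel {a b c : A} (h : a ≤ b) (h' : R.rel b c) : R.rel a c :=
  R.trans (R.of_le h) h'

theorem rel_of_rel_of_le {a b c : A} (h : R.rel a b) (h' : b ≤ c) : R.rel a c :=
  R.trans h (R.of_le h')

/-- The least compatible preorder containing `R` in which `u` is below `0`. -/
def collapseToZero (u : A) : CompatiblePreorder A where
  rel a b := ∃ n, R.rel a (b ⊕ₘ nOplus u n)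
  of_le h := ⟨0, R.of_le (h.trans (le_oplus_left _ _))⟩
  trans := by
    rintro a b c ⟨n, h⟩ ⟨m, h'⟩
    refine ⟨m + n, ?_⟩
    rw [nOplus_add, ← MCAlgebra.oplus_assoc]
    exact R.trans h (R.oplus h' (R.refl _))
  sup := by
    rintro a b c d ⟨n, h⟩ ⟨m, h'⟩
    refine ⟨n + m, ?_⟩
    rw [MCAlgebra.sup_oplus]
    refine R.sup (R.rel_of_rel_of_le h (oplus_le_oplus le_rfl ?_))
      (R.rel_of_rel_of_le h' (oplus_le_oplus le_rfl ?_))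
    · rw [nOplus_add]; exact le_oplus_left _ _
    · rw [add_comm, nOplus_add]; exact le_oplus_left _ _
  inf := by
    rintro a b c d ⟨n, h⟩ ⟨m, h'⟩
    refine ⟨n + m, ?_⟩
    rw [MCAlgebra.inf_oplus]
    refine R.inf (R.rel_of_rel_of_le h (oplus_le_oplus le_rfl ?_))
      (R.rel_of_rel_of_le h' (oplus_le_oplus le_rfl ?_))
    · rw [nOplus_add]; exact le_oplus_left _ _
    · rw [add_comm, nOplus_add]; exact le_oplus_left _ _
  oplus := by
    rintro a b c d ⟨n, h⟩ ⟨m, h'⟩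
    refine ⟨n + m, ?_⟩
    rw [nOplus_add, oplus_oplus_oplus_comm]
    exact R.oplus h h'
  odot := by
    rintro a b c d ⟨n, h⟩ ⟨m, h'⟩
    refine ⟨n + m, ?_⟩
    rw [nOplus_add]
    exact R.rel_of_rel_of_le (R.odot h h') (oplus_odot_oplus_le _ _ _ _)

/-- The least compatible preorder containing `R` in which `w` is above `1`. -/
def collapseToOne (w : A) : CompatiblePreorder A where
  rel a b := ∃ n, R.rel (a ⊙ₘ nOdot w n) b
  of_le h := ⟨0, R.of_le ((odot_le_left _ _).trans h)⟩
  trans := by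
    rintro a b c ⟨n, h⟩ ⟨m, h'⟩
    refine ⟨n + m, ?_⟩
    rw [nOdot_add, ← MCAlgebra.odot_assoc]
    exact R.trans (R.odot h (R.refl _)) h'
  sup := by
    rintro a b c d ⟨n, h⟩ ⟨m, h'⟩
    refine ⟨n + m, ?_⟩
    rw [MCAlgebra.sup_odot]
    refine R.sup (R.rel_of_le_of_rel (odot_le_odot le_rfl ?_) h)
      (R.rel_of_le_of_rel (odot_le_odot le_rfl ?_) h')
    · rw [nOdot_add]; exact odot_le_left _ _
    · rw [add_comm, nOdot_add]; exact odot_le_left _ _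
  inf := by
    rintro a b c d ⟨n, h⟩ ⟨m, h'⟩
    refine ⟨n + m, ?_⟩
    rw [MCAlgebra.inf_odot]
    refine R.inf (R.rel_of_le_of_rel (odot_le_odot le_rfl ?_) h)
      (R.rel_of_le_of_rel (odot_le_odot le_rfl ?_) h')
    · rw [nOdot_add]; exact odot_le_left _ _
    · rw [add_comm, nOdot_add]; exact odot_le_left _ _
  oplus := by
    rintro a b c d ⟨n, h⟩ ⟨m, h'⟩
    refine ⟨n + m, ?_⟩
    rw [nOdot_add]
    exact R.rel_of_le_of_rel (oplus_odot_odot_le _ _ _ _) (R.oplus h h')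
  odot := by
    rintro a b c d ⟨n, h⟩ ⟨m, h'⟩
    refine ⟨n + m, ?_⟩
    rw [nOdot_add, odot_odot_odot_comm]
    exact R.odot h h'

theorem le_collapseToZero (u : A) : R ≤ R.collapseToZero u := fun _ _ h =>
  ⟨0, R.rel_of_rel_of_le h (le_oplus_left _ _)⟩

theorem le_collapseToOne (w : A) : R ≤ R.collapseToOne w := fun _ _ h =>
  ⟨0, R.rel_of_le_of_rel (odot_le_left _ _) h⟩

theorem collapseToZero_rel_zero (u : A) : (R.collapseToZero u).rel u (const 0) :=
  ⟨1, R.of_le (by rw [nOplus_one, MCAlgebra.oplus_comm, MCAlgebra.oplus_zero])⟩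

theorem collapseToOne_rel_one (w : A) : (R.collapseToOne w).rel (const 1) w :=
  ⟨1, R.of_le (by rw [nOdot_one, MCAlgebra.odot_comm, MCAlgebra.odot_one])⟩

/-- The preorders collapsing `c ⊙ l` to `0` and `c ⊕ l` to `1` intersect in `R`. This is the
content of the only axiom that involves multiples and powers. -/
theorem rel_of_collapse {a b : A} (c : A) (l : unitInterval)
    (h₀ : (R.collapseToZero (c ⊙ₘ const l)).rel a b)
    (h₁ : (R.collapseToOne (c ⊕ₘ const l)).rel a b) : R.rel a b := by
  obtain ⟨n, h₀⟩ := h₀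
  obtain ⟨m, h₁⟩ := h₁
  have h : R.rel a (a ⊓ (b ⊕ₘ nOplus (c ⊙ₘ const l) n)) :=
    R.rel_of_le_of_rel (le_inf le_rfl le_rfl) (R.inf (R.refl a) h₀)
  exact R.rel_of_rel_of_le (R.trans h (R.rel_of_le_of_rel
    (MCAlgebra.inf_nOplus_le n m l a b c) (R.sup h₁ (R.refl b)))) (sup_idem b).le

/-- Zorn's lemma: a pair outside the order is omitted by some maximal compatible preorder. -/
theorem exists_maximal_not_rel {a b : A} (h : ¬a ≤ b) :
    ∃ R : CompatiblePreorder A, Maximal (fun S : CompatiblePreorder A => ¬S.rel a b) R := by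
  obtain ⟨R, -, hR⟩ := zorn_le_nonempty₀ {S : CompatiblePreorder A | ¬S.rel a b}
    (fun c hcs hc S hS => ⟨sUnion c hc ⟨S, hS⟩, fun ⟨T, hT, hab⟩ => hcs hT hab,
      fun T hT _ _ hxy => ⟨T, hT, hxy⟩⟩) (ofLE A) h
  exact ⟨R, hR⟩

/-- A maximal compatible preorder that omits a pair compares every element with every constant:
otherwise both collapsing preorders would be strictly larger, hence contain the pair. -/
theorem const_rel_or_rel_const {R : CompatiblePreorder A} {a b : A}
    (hR : Maximal (fun S : CompatiblePreorder A => ¬S.rel a b) R) (c : A) (l : unitInterval) :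
    R.rel (const l) c ∨ R.rel c (const l) := by
  set m := unitInterval.symm l with hm
  by_cases h₀ : (R.collapseToZero (c ⊙ₘ const m)).rel a b
  · have h₁ : ¬(R.collapseToOne (c ⊕ₘ const m)).rel a b := fun h₁ =>
      hR.prop (R.rel_of_collapse c m h₀ h₁)
    have h := hR.le_of_ge h₁ (R.le_collapseToOne _) _ _ (R.collapseToOne_rel_one _)
    refine Or.inl (R.rel_of_le_of_rel ?_ (R.rel_of_rel_of_le (R.odot h (R.refl (const l))) ?_))
    · rw [MCAlgebra.odot_comm, MCAlgebra.odot_one]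
    · have := MCAlgebra.oplus_odot_le_self m c
      rwa [hm, unitInterval.symm_symm] at this
  · have h := hR.le_of_ge h₀ (R.le_collapseToZero _) _ _ (R.collapseToZero_rel_zero _)
    refine Or.inr (R.rel_of_le_of_rel ?_ (R.rel_of_rel_of_le (R.oplus h (R.refl (const l))) ?_))
    · have := MCAlgebra.le_odot_oplus l c
      rwa [← hm] at this
    · rw [MCAlgebra.oplus_comm, MCAlgebra.oplus_zero]

/-- In a preorder other than the total relation, constants keep their order: a larger constant
below a smaller one would, after a subtraction, put a positive constant and hence all its
multiples below `0`. -/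
theorem le_of_const_rel_const {a b : A} (hab : ¬R.rel a b) {l m : unitInterval}
    (h : R.rel (const m) (const l)) : m ≤ l := by
  by_contra! hlm
  have hδ := R.odot h (R.refl (const (unitInterval.symm l)))
  rw [MCAlgebra.const_odot, MCAlgebra.const_odot] at hδ
  have hl : l ⊙ₘ unitInterval.symm l = 0 := Subtype.ext (by
    rw [coe_odot, unitInterval.coe_symm_eq, Set.Icc.coe_zero]
    exact max_eq_right (by linarith))
  have hm : 0 < m ⊙ₘ unitInterval.symm l := Subtype.coe_lt_coe.1 (by
    rw [coe_odot, unitInterval.coe_symm_eq, Set.Icc.coe_zero]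
    exact lt_max_of_lt_left (by linarith [Subtype.coe_lt_coe.2 hlm]))
  rw [hl] at hδ
  obtain ⟨n, hn⟩ := exists_nOplus_eq_one hm
  have hmul : ∀ k, R.rel (nOplus (const (m ⊙ₘ unitInterval.symm l)) k) (const 0) := by
    intro k
    induction k with
    | zero => exact R.refl _
    | succ k ih => exact R.rel_of_rel_of_le (R.oplus ih hδ) (MCAlgebra.oplus_zero _).le
  have h₁ := hmul n
  rw [nOplus_const, hn, MCAlgebra.const_one, MCAlgebra.const_zero] at h₁
  exact hab (R.rel_of_le_of_rel le_top (R.rel_of_rel_of_le h₁ bot_le))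

/-- The supremum of the constants below `c`. -/
noncomputable def value (c : A) : unitInterval :=
  sSup {l | R.rel (const l) c}

theorem isLUB_value (c : A) : IsLUB {l | R.rel (const l) c} (R.value c) := isLUB_sSup _

theorem value_mem_closure_lower (c : A) : R.value c ∈ closure {l | R.rel (const l) c} :=
  (R.isLUB_value c).mem_closure ⟨0, R.of_le (MCAlgebra.const_zero.trans_le bot_le)⟩

section Maximal

variable {R} {a b : A}

/-- For a maximal preorder, the value is also the infimum of the constants above. -/
theorem isGLB_value (hR : Maximal (fun S : CompatiblePreorder A => ¬S.rel a b) R) (c : A) :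
    IsGLB {l | R.rel c (const l)} (R.value c) := by
  refine ⟨fun l hl => (R.isLUB_value c).2 fun m hm =>
    R.le_of_const_rel_const hR.prop (R.trans hm hl), fun t ht => ?_⟩
  by_contra! h
  obtain ⟨m, hm, hmt⟩ := exists_between h
  rcases const_rel_or_rel_const hR c m with h' | h'
  · exact hm.not_ge ((R.isLUB_value c).1 h')
  · exact hmt.not_ge (ht h')

theorem value_mem_closure_upper (hR : Maximal (fun S : CompatiblePreorder A => ¬S.rel a b) R)
    (c : A) : R.value c ∈ closure {l | R.rel c (const l)} :=
  (isGLB_value hR c).mem_closure ⟨1, R.of_le (le_top.trans_eq MCAlgebra.const_one.symm)⟩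

/-- Every operation that preserves `R` and restricts to a continuous operation on the constants is
preserved by `value`. -/
theorem value_map₂ (hR : Maximal (fun S : CompatiblePreorder A => ¬S.rel a b) R) {f : A → A → A}
    {g : unitInterval → unitInterval → unitInterval} (hg : Continuous (Function.uncurry g))
    (hf : ∀ {a b c d}, R.rel a b → R.rel c d → R.rel (f a c) (f b d))
    (hfg : ∀ l m, f (const l) (const m) = const (g l m)) (c d : A) :
    R.value (f c d) = g (R.value c) (R.value d) := by
  refine le_antisymm ?_ ?_
  · have h := map_mem_closure₂ (u := Set.Ici (R.value (f c d))) hg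
      (value_mem_closure_upper hR c) (value_mem_closure_upper hR d)
      fun l hl m hm => (isGLB_value hR (f c d)).1 (by
        rw [Set.mem_ofPred_eq, ← hfg]; exact hf hl hm)
    rwa [isClosed_Ici.closure_eq] at h
  · have h := map_mem_closure₂ (u := Set.Iic (R.value (f c d))) hg
      (R.value_mem_closure_lower c) (R.value_mem_closure_lower d)
      fun l hl m hm => (R.isLUB_value (f c d)).1 (by
        rw [Set.mem_ofPred_eq, ← hfg]; exact hf hl hm)
    rwa [isClosed_Iic.closure_eq] at h

/-- The homomorphism to `[0,1]` given by a maximal preorder. -/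
noncomputable def valueHom (hR : Maximal (fun S : CompatiblePreorder A => ¬S.rel a b) R) :
    MCHom A unitInterval where
  toFun := R.value
  map_sup := value_map₂ hR continuous_sup R.sup MCAlgebra.const_sup
  map_inf := value_map₂ hR continuous_inf R.inf MCAlgebra.const_inf
  map_oplus := value_map₂ hR continuous_oplus_unitInterval R.oplus MCAlgebra.const_oplus
  map_odot := value_map₂ hR continuous_odot_unitInterval R.odot MCAlgebra.const_odot
  map_const _ := le_antisymm
    ((R.isLUB_value _).2 fun _ hm => R.le_of_const_rel_const hR.prop hm)
    ((R.isLUB_value _).1 (R.refl _))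

theorem value_le_value (hR : Maximal (fun S : CompatiblePreorder A => ¬S.rel a b) R) :
    R.value b ≤ R.value a := by
  by_contra! h
  obtain ⟨l, hal, hlb⟩ := exists_between h
  have h₁ : R.rel a (const l) := (const_rel_or_rel_const hR a l).resolve_left fun h' =>
    hal.not_ge ((R.isLUB_value a).1 h')
  have h₂ : R.rel (const l) b := (const_rel_or_rel_const hR b l).resolve_right fun h' =>
    hlb.not_ge ((isGLB_value hR b).1 h')
  exact hR.prop (R.trans h₁ h₂)

end Maximal

end CompatiblePreorder

/-! ### The distance and the homomorphisms to `[0,1]` -/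

section Distance

variable {A : Type u} [MCAlgebra A]

theorem exists_hom_le_of_not_le {a b : A} (h : ¬a ≤ b) :
    ∃ v : MCHom A unitInterval, v b ≤ v a := by
  obtain ⟨R, hR⟩ := CompatiblePreorder.exists_maximal_not_rel h
  exact ⟨CompatiblePreorder.valueHom hR, CompatiblePreorder.value_le_value hR⟩

theorem MCHom.mono {B : Type v} [MCAlgebra B] (f : MCHom A B) {a b : A} (h : a ≤ b) :
    f a ≤ f b := by
  have := f.map_sup a b
  rw [sup_eq_right.2 h] at this
  exact sup_eq_right.1 this.symm

theorem apply_oplus_const (v : MCHom A unitInterval) (a : A) (l : unitInterval) :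
    v (a ⊕ₘ const l) = v a ⊕ₘ l :=
  (v.map_oplus a _).trans (congrArg _ (v.map_const l))

theorem apply_odot_const (v : MCHom A unitInterval) (a : A) (l : unitInterval) :
    v (a ⊙ₘ const l) = v a ⊙ₘ l :=
  (v.map_odot a _).trans (congrArg _ (v.map_const l))

/-- Inequalities up to a constant are detected by the homomorphisms to `[0,1]`. -/
theorem le_oplus_const_of_forall {a b : A} {δ : ℝ} (hδ : 0 ≤ δ)
    (h : ∀ v : MCHom A unitInterval, (v a : ℝ) ≤ v b + δ) {l : unitInterval} (hl : δ < l) :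
    a ≤ b ⊕ₘ const l := by
  by_contra hab
  -- Splitting `l` in two halves, one subtracted from `a` and one added to `b`, keeps the
  -- truncations from hiding the difference of the values.
  have hl₀ := l.2.1
  have hl₁ := l.2.2
  let m : unitInterval := ⟨l / 2, by linarith, by linarith⟩
  have hm : (m : ℝ) = l / 2 := rfl
  have hlm : l = m ⊕ₘ m := Subtype.ext (by
    rw [coe_oplus, hm, add_halves, min_eq_left hl₁])
  rw [hlm, ← MCAlgebra.const_oplus, ← MCAlgebra.oplus_assoc, ← odot_const_symm_le_iff] at hab
  obtain ⟨v, hv⟩ := exists_hom_le_of_not_le hab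
  rw [apply_oplus_const, apply_odot_const, ← Subtype.coe_le_coe, coe_oplus, coe_odot,
    unitInterval.coe_symm_eq, hm] at hv
  have := h v
  have := (v a).2.2
  have := (v b).2.1
  grind

theorem distUp_nonneg (a b : A) : 0 ≤ distUp a b :=
  Real.sInf_nonneg (by rintro _ ⟨l, -, rfl⟩; exact l.2.1)

theorem mcDist_nonneg (a b : A) : 0 ≤ mcDist a b := le_max_of_le_left (distUp_nonneg a b)

theorem distUp_le {a b : A} {l : unitInterval} (h : b ≤ a ⊕ₘ const l) : distUp a b ≤ l :=
  csInf_le ⟨0, by rintro _ ⟨l, -, rfl⟩; exact l.2.1⟩ ⟨l, h, rfl⟩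

theorem distUp_le_of_forall {a b : A} {δ : ℝ} (hδ : 0 ≤ δ)
    (h : ∀ v : MCHom A unitInterval, (v b : ℝ) ≤ v a + δ) : distUp a b ≤ δ := by
  refine le_of_forall_gt_imp_ge_of_dense fun r hr => ?_
  rcases le_total r 1 with h1 | h1
  · exact distUp_le (l := ⟨r, hδ.trans hr.le, h1⟩) (le_oplus_const_of_forall hδ h hr)
  · refine (distUp_le (l := 1) ?_).trans h1
    rw [MCAlgebra.oplus_one, MCAlgebra.const_one]
    exact le_top

/-- The distance is at most the supremum distance on the space of homomorphisms to `[0,1]`. -/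
theorem mcDist_le_of_forall {a b : A} {δ : ℝ} (hδ : 0 ≤ δ)
    (h : ∀ v : MCHom A unitInterval, |(v a : ℝ) - v b| ≤ δ) : mcDist a b ≤ δ :=
  max_le (distUp_le_of_forall hδ fun v => by linarith [neg_le_of_abs_le (h v)])
    (distUp_le_of_forall hδ fun v => by linarith [le_of_abs_le (h v)])

theorem apply_le_add_distUp (v : MCHom A unitInterval) (a b : A) :
    (v b : ℝ) ≤ v a + distUp a b := by
  rw [← sub_le_iff_le_add']
  refine le_csInf ⟨1, 1, ?_, Set.Icc.coe_one⟩ ?_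
  · rw [Set.mem_ofPred_eq, MCAlgebra.oplus_one, MCAlgebra.const_one]
    exact le_top
  · rintro _ ⟨l, hl, rfl⟩
    have h := v.mono hl
    rw [apply_oplus_const, ← Subtype.coe_le_coe, coe_oplus] at h
    linarith [h.trans (min_le_left _ _)]

/-- Homomorphisms to `[0,1]` are nonexpansive. -/
theorem abs_apply_sub_apply_le (v : MCHom A unitInterval) (a b : A) :
    |(v a : ℝ) - v b| ≤ mcDist a b := by
  rw [abs_sub_le_iff]
  unfold mcDist
  exact ⟨by linarith [apply_le_add_distUp v b a, le_max_right (distUp a b) (distUp b a)],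
    by linarith [apply_le_add_distUp v a b, le_max_left (distUp a b) (distUp b a)]⟩

end Distance

/-! ### The space of homomorphisms to `[0,1]` -/

section Spectrum

variable {A : Type u} [MCAlgebra A]

theorem isInducing_coe_mcHom :
    Topology.IsInducing fun x : MCHom A unitInterval => (x : A → unitInterval) :=
  ⟨by
    rw [Pi.topologicalSpace, induced_iInf]
    simp only [induced_compose]
    rfl⟩

theorem isClosedEmbedding_coe_mcHom :
    Topology.IsClosedEmbedding fun x : MCHom A unitInterval => (x : A → unitInterval) := by
  refine ⟨⟨isInducing_coe_mcHom, DFunLike.coe_injective⟩, ?_⟩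
  have hrange : Set.range (fun x : MCHom A unitInterval => (x : A → unitInterval)) =
      {f | (∀ a b, f (a ⊔ b) = f a ⊔ f b) ∧ (∀ a b, f (a ⊓ b) = f a ⊓ f b) ∧
        (∀ a b, f (a ⊕ₘ b) = f a ⊕ₘ f b) ∧ (∀ a b, f (a ⊙ₘ b) = f a ⊙ₘ f b) ∧
        ∀ l, f (const l) = l} := by
    ext f
    constructor
    · rintro ⟨x, rfl⟩
      exact ⟨x.map_sup, x.map_inf, x.map_oplus, x.map_odot, x.map_const⟩
    · rintro ⟨h₁, h₂, h₃, h₄, h₅⟩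
      exact ⟨⟨f, h₁, h₂, h₃, h₄, h₅⟩, rfl⟩
  have hclosed : ∀ {g : unitInterval × unitInterval → unitInterval} (_ : Continuous g)
      (op : A → A → A), IsClosed {f : A → unitInterval | ∀ a b, f (op a b) = g (f a, f b)} := by
    intro g hg op
    simp only [Set.ofPred_forall]
    exact isClosed_iInter fun a => isClosed_iInter fun b => isClosed_eq (by fun_prop) (by fun_prop)
  rw [hrange]
  refine (hclosed continuous_sup (· ⊔ ·)).inter ((hclosed continuous_inf (· ⊓ ·)).inter
    ((hclosed continuous_oplus_unitInterval oplus).inter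
      ((hclosed continuous_odot_unitInterval odot).inter ?_)))
  change IsClosed {f : A → unitInterval | ∀ l, f (const l) = l}
  simp only [Set.ofPred_forall]
  exact isClosed_iInter fun l => isClosed_eq (by fun_prop) continuous_const

instance instCompactSpaceMCHom : CompactSpace (MCHom A unitInterval) :=
  isClosedEmbedding_coe_mcHom.compactSpace

instance instT2SpaceMCHom : T2Space (MCHom A unitInterval) :=
  isClosedEmbedding_coe_mcHom.isEmbedding.t2Space

theorem isClosed_le_mcHom :
    IsClosed {p : MCHom A unitInterval × MCHom A unitInterval | p.1 ≤ p.2} := by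
  change IsClosed {p : MCHom A unitInterval × MCHom A unitInterval | ∀ a, p.1 a ≤ p.2 a}
  simp only [Set.ofPred_forall]
  exact isClosed_iInter fun a => isClosed_le ((continuous_eval a).comp continuous_fst)
    ((continuous_eval a).comp continuous_snd)

theorem isCompactOrdered_max (A : MC.{u}) : IsCompactOrdered (Max.obj (op A)) :=
  ⟨inferInstanceAs (CompactSpace (MCHom A unitInterval)),
    fun (x y : MCHom A unitInterval) h h' => DFunLike.ext x y fun a => (h a).antisymm (h' a),
    isClosed_le_mcHom⟩

/-! ### Evaluation at the elements of the algebra -/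

theorem apply_nOplus (v : MCHom A unitInterval) (a : A) (n : ℕ) :
    v (nOplus a n) = nOplus (v a) n := by
  induction n with
  | zero => exact v.map_const 0
  | succ n ih => exact (v.map_oplus _ _).trans (congrArg (· ⊕ₘ v a) ih)

theorem apply_finset_sup (v : MCHom A unitInterval) {ι : Type*} (s : Finset ι) (f : ι → A) :
    v (s.sup f) = s.sup fun i => v (f i) :=
  Finset.apply_sup_eq_sup_comp v v.map_sup
    ((congrArg v MCAlgebra.const_zero.symm).trans (v.map_const 0))

theorem apply_finset_inf (v : MCHom A unitInterval) {ι : Type*} (s : Finset ι) (f : ι → A) :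
    v (s.inf f) = s.inf fun i => v (f i) :=
  Finset.apply_inf_eq_inf_comp v v.map_inf
    ((congrArg v MCAlgebra.const_one.symm).trans (v.map_const 1))

/-- Elements separate homomorphisms in the strongest possible way: subtract a constant lying
between the two values, and take a large multiple. -/
theorem exists_apply_eq_one_zero {x y : MCHom A unitInterval} (h : ¬x ≤ y) :
    ∃ a : A, x a = 1 ∧ y a = 0 := by
  obtain ⟨a, ha⟩ : ∃ a, y a < x a := by
    by_contra! h'
    exact h h'
  have hy : y a ⊙ₘ unitInterval.symm (y a) = 0 := Subtype.ext (by
    rw [coe_odot, unitInterval.coe_symm_eq, Set.Icc.coe_zero]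
    exact max_eq_right (by linarith))
  have hx : 0 < x a ⊙ₘ unitInterval.symm (y a) := Subtype.coe_lt_coe.1 (by
    rw [coe_odot, unitInterval.coe_symm_eq, Set.Icc.coe_zero]
    exact lt_max_of_lt_left (by linarith [Subtype.coe_lt_coe.2 ha]))
  obtain ⟨n, hn⟩ := exists_nOplus_eq_one hx
  refine ⟨nOplus (a ⊙ₘ const (unitInterval.symm (y a))) n, ?_, ?_⟩
  · rw [apply_nOplus, apply_odot_const, hn]
  · rw [apply_nOplus, apply_odot_const, hy, nOplus_zero_unitInterval]

theorem exists_le_apply_and_apply_le (f : MCHom A unitInterval →Co unitInterval)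
    (x y : MCHom A unitInterval) : ∃ a : A, f x ≤ x a ∧ y a ≤ f y := by
  by_cases h : x ≤ y
  · exact ⟨const (f x), (x.map_const _).ge, (y.map_const _).trans_le (f.monotone' h)⟩
  · obtain ⟨a, hx, hy⟩ := exists_apply_eq_one_zero h
    exact ⟨a, le_top.trans_eq hx.symm, hy.trans_le bot_le⟩

/-- The lattice version of the Stone–Weierstrass theorem, for monotone functions. -/
theorem exists_abs_apply_sub_lt (f : MCHom A unitInterval →Co unitInterval) {ε : ℝ} (hε : 0 < ε) :
    ∃ a : A, ∀ x : MCHom A unitInterval, |(x a : ℝ) - f x| < ε := by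
  have hf : Continuous fun z => (f z : ℝ) := continuous_subtype_val.comp f.continuous_toFun
  have hev : ∀ a : A, Continuous fun z : MCHom A unitInterval => (z a : ℝ) := fun a =>
    continuous_subtype_val.comp (continuous_eval a)
  choose g hg₁ hg₂ using exists_le_apply_and_apply_le f
  have upper : ∀ x : MCHom A unitInterval,
      ∃ a : A, f x ≤ x a ∧ ∀ z : MCHom A unitInterval, (z a : ℝ) < f z + ε := by
    intro x
    obtain ⟨t, ht⟩ := isCompact_univ.elim_finite_subcover
      (fun y => {z : MCHom A unitInterval | (z (g x y) : ℝ) < f z + ε})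
      (fun y => isOpen_lt (hev _) (hf.add continuous_const)) fun y _ => Set.mem_iUnion.2 ⟨y, by
        have := Subtype.coe_le_coe.2 (hg₂ x y)
        change ((y (g x y) : unitInterval) : ℝ) < f y + ε
        linarith⟩
    refine ⟨t.inf (g x), ?_, fun z => ?_⟩
    · rw [apply_finset_inf]
      exact Finset.le_inf fun y _ => hg₁ x y
    · obtain ⟨y, hy, hz⟩ := Set.mem_iUnion₂.1 (ht (Set.mem_univ z))
      rw [apply_finset_inf]
      exact (Subtype.coe_le_coe.2 (Finset.inf_le hy)).trans_lt hz
  choose h hh₁ hh₂ using upper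
  obtain ⟨t, ht⟩ := isCompact_univ.elim_finite_subcover
    (fun x => {z : MCHom A unitInterval | (f z : ℝ) - ε < z (h x)})
    (fun x => isOpen_lt (hf.sub continuous_const) (hev _)) fun x _ => Set.mem_iUnion.2 ⟨x, by
      have := Subtype.coe_le_coe.2 (hh₁ x)
      change (f x : ℝ) - ε < (x (h x) : unitInterval)
      linarith⟩
  refine ⟨t.sup h, fun z => ?_⟩
  rw [apply_finset_sup, abs_sub_lt_iff]
  obtain ⟨x, hx, hz⟩ := Set.mem_iUnion₂.1 (ht (Set.mem_univ z))
  constructor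
  · obtain ⟨x', -, hx'⟩ := t.exists_mem_eq_sup ⟨x, hx⟩ fun i => z (h i)
    rw [hx']
    linarith [hh₂ x' z]
  · have := Subtype.coe_le_coe.2 (Finset.le_sup (f := fun i => z (h i)) hx)
    change (f z : ℝ) - ε < (z (h x) : unitInterval) at hz
    linarith

theorem evalElement_injective (hA : IsArchimedean A) :
    Function.Injective (evalElement : A → _) := fun a b h =>
  hA a b ((mcDist_le_of_forall le_rfl fun v => by
    have hv : v a = v b := DFunLike.congr_fun h v
    rw [hv, sub_self, abs_zero]).antisymm (mcDist_nonneg a b))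

theorem evalElement_surjective (hA : IsCauchyComplete A) :
    Function.Surjective (evalElement : A → _) := by
  intro f
  have hpos : ∀ n : ℕ, (0 : ℝ) < 1 / (n + 1) := fun n => Nat.one_div_pos_of_nat
  choose a ha using fun n => exists_abs_apply_sub_lt f (hpos n)
  have hcauchy : IsCauchySequence a := by
    intro ε hε
    obtain ⟨k, hk⟩ := exists_nat_one_div_lt (show 0 < ε / 3 by positivity)
    have hsmall : ∀ n, k ≤ n → ∀ v : MCHom A unitInterval, |(v (a n) : ℝ) - f v| ≤ ε / 3 :=
      fun n hn v => ((ha n v).trans_le (Nat.one_div_le_one_div hn)).le.trans hk.le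
    refine ⟨k, fun n m hn hm => (mcDist_le_of_forall (δ := ε / 3 + ε / 3) (by positivity)
      fun v => ?_).trans_lt (by linarith)⟩
    have h := abs_sub_le (v (a n) : ℝ) (f v) (v (a m))
    rw [abs_sub_comm (f v : ℝ)] at h
    exact h.trans (add_le_add (hsmall n hn v) (hsmall m hm v))
  obtain ⟨b, hb⟩ := hA a hcauchy
  refine ⟨b, DFunLike.ext _ _ fun v => Subtype.ext ?_⟩
  change ((v b : unitInterval) : ℝ) = f v
  have h₁ : Filter.Tendsto (fun n => (v (a n) : ℝ)) Filter.atTop (nhds (v b)) :=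
    Metric.tendsto_atTop.2 fun ε hε => (hb ε hε).imp fun n hn m hm =>
      (abs_apply_sub_apply_le v (a m) b).trans_lt (hn m hm)
  have h₂ : Filter.Tendsto (fun n => (v (a n) : ℝ)) Filter.atTop (nhds (f v)) :=
    tendsto_iff_dist_tendsto_zero.2 (squeeze_zero (fun _ => dist_nonneg)
      (fun n => (ha n v).le) tendsto_one_div_add_atTop_nhds_zero_nat)
  exact tendsto_nhds_unique h₁ h₂

end Spectrum

/-! ### Monotone Urysohn lemma -/

/-- In Urysohn's construction, the functions are monotone if all the open sets are lower sets. -/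
theorem monotone_lim_of_isLowerSet {X : Type u} [TopologicalSpace X] [Preorder X]
    (c : Urysohns.CU fun _ u : Set X => IsLowerSet u) :
    Monotone c.lim := by
  have happrox : ∀ (n : ℕ) (c : Urysohns.CU fun _ u : Set X => IsLowerSet u),
      Monotone (c.approx n) := by
    intro n
    induction n with
    | zero =>
      intro c x y hxy
      by_cases hx : x ∈ c.U
      · rw [Urysohns.CU.approx, Set.indicator_of_notMem (Set.notMem_compl_iff.2 hx)]
        exact c.approx_nonneg 0 y
      · rw [c.approx_of_notMem_U 0 hx, c.approx_of_notMem_U 0 fun hy => hx (c.P_C_U hxy hy)]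
    | succ n ih =>
      intro c x y hxy
      simp only [Urysohns.CU.approx, midpoint_eq_smul_add, smul_eq_mul, invOf_eq_inv]
      have := ih c.left hxy
      have := ih c.right hxy
      gcongr
  exact fun x y hxy => ciSup_mono (c.bddAbove_range_approx y) fun n => happrox n c hxy

section Urysohn

variable {X : Type u} [TopologicalSpace X] [CompactSpace X]

theorem isClosed_upperClosure_of_compact [Preorder X] [OrderClosedTopology X] {s : Set X}
    (hs : IsClosed s) : IsClosed (upperClosure s : Set X) := by
  have h : (upperClosure s : Set X) = Prod.snd '' ({p : X × X | p.1 ≤ p.2} ∩ Prod.fst ⁻¹' s) := by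
    ext y
    simp [and_comm]
  rw [h]
  exact isClosedMap_snd_of_compactSpace _
    (OrderClosedTopology.isClosed_le'.inter (hs.preimage continuous_fst))

theorem isClosed_lowerClosure_of_compact [Preorder X] [OrderClosedTopology X] {s : Set X}
    (hs : IsClosed s) : IsClosed (lowerClosure s : Set X) :=
  have : CompactSpace Xᵒᵈ := ‹CompactSpace X›
  isClosed_upperClosure_of_compact (X := Xᵒᵈ) hs

theorem exists_isOpen_isLowerSet_closure_subset [PartialOrder X] [OrderClosedTopology X]
    {c u : Set X} (hc : IsClosed c) (hu : IsOpen u) (hu' : IsLowerSet u) (hcu : c ⊆ u) :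
    ∃ v : Set X, IsOpen v ∧ IsLowerSet v ∧ c ⊆ v ∧ closure v ⊆ u := by
  obtain ⟨w, hw, hcw, hwu⟩ := normal_exists_closure_subset
    (isClosed_lowerClosure_of_compact hc) hu (lowerClosure_min hcu hu')
  -- The largest lower set contained in `w`.
  refine ⟨(upperClosure wᶜ : Set X)ᶜ,
    (isClosed_upperClosure_of_compact hw.isClosed_compl).isOpen_compl,
    (upperClosure wᶜ).upper.compl, fun x hx hx' => ?_, (closure_mono ?_).trans hwu⟩
  · obtain ⟨y, hy, hyx⟩ := hx'
    exact hy (hcw ⟨x, hx, hyx⟩)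
  · exact Set.compl_subset_comm.1 subset_upperClosure

/-- The monotone continuous functions to `[0,1]` determine the order of a compact ordered space. -/
theorem exists_apply_lt_of_not_le [PartialOrder X] [OrderClosedTopology X] {x y : X}
    (h : ¬x ≤ y) : ∃ f : X →Co unitInterval, f y < f x := by
  let c : Urysohns.CU fun _ u : Set X => IsLowerSet u :=
    { C := Set.Iic y
      U := (Set.Ici x)ᶜ
      P_C_U := (isUpperSet_Ici x).compl
      closed_C := isClosed_Iic
      open_U := isClosed_Ici.isOpen_compl
      subset := fun z hz hz' => h (le_trans hz' hz)
      hP := fun {c u} hc hP hu hcu => by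
        obtain ⟨v, h₁, h₂, h₃, h₄⟩ := exists_isOpen_isLowerSet_closure_subset hc hu hP hcu
        exact ⟨v, h₁, h₃, h₄, h₂, hP⟩ }
  refine ⟨⟨⟨fun z => ⟨c.lim z, c.lim_mem_Icc z⟩, fun _ _ hz => monotone_lim_of_isLowerSet c hz⟩,
    c.continuous_lim.subtype_mk _⟩, Subtype.coe_lt_coe.1 ?_⟩
  change c.lim y < c.lim x
  rw [c.lim_of_mem_C y Set.self_mem_Iic, c.lim_of_notMem_U x fun hx => hx Set.self_mem_Ici]
  exact zero_lt_one

end Urysohn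

/-! ### Evaluation at the points of a compact ordered space -/

section EvalPoint

variable {X : Type u} [TopologicalSpace X] [CompactSpace X]

/-- If a homomorphism `v` maps `f` to `0` and `g` to `1`, then `f` vanishes and `g` is `1` at a
common point. -/
theorem exists_apply_eq_zero_and_one [Preorder X] (v : MCHom (X →Co unitInterval) unitInterval)
    {f g : X →Co unitInterval} (hf : v f = 0) (hg : v g = 1) : ∃ x, f x = 0 ∧ g x = 1 := by
  by_contra! h
  -- By compactness, some multiple of `f` is `1` wherever `g` is close to `1`.
  let s : ℕ → Set X := fun k => {x | 1 / ((k : ℝ) + 1) < f x} ∪ {x | (g x : ℝ) < 1 - 1 / (k + 1)}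
  have hs : Monotone s := fun k l hkl => by
    have := Nat.one_div_le_one_div (α := ℝ) hkl
    exact Set.union_subset_union (fun x hx => lt_of_le_of_lt this hx)
      fun x hx => lt_of_lt_of_le hx (sub_le_sub_left this 1)
  have hcover : Set.univ ⊆ ⋃ k, s k := by
    intro x _
    rw [Set.mem_iUnion]
    by_cases hx : f x = 0
    · have hlt : (0 : ℝ) < 1 - g x :=
        sub_pos.2 (unitInterval.lt_one_iff_ne_one.2 (h x hx))
      obtain ⟨k, hk⟩ := exists_nat_one_div_lt hlt
      exact ⟨k, Or.inr (by change (g x : ℝ) < _; linarith)⟩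
    · have hlt : (0 : ℝ) < f x := unitInterval.pos_iff_ne_zero.2 hx
      obtain ⟨k, hk⟩ := exists_nat_one_div_lt hlt
      exact ⟨k, Or.inl hk⟩
  obtain ⟨k, hk⟩ := isCompact_univ.elim_directed_cover s (fun k =>
    (isOpen_lt continuous_const (continuous_subtype_val.comp f.continuous_toFun)).union
      (isOpen_lt (continuous_subtype_val.comp g.continuous_toFun) continuous_const))
    hcover hs.directed_le
  have hpos : (0 : ℝ) < 1 / ((k : ℝ) + 1) := Nat.one_div_pos_of_nat
  have hle : (1 : ℝ) / ((k : ℝ) + 1) ≤ 1 := by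
    simpa using Nat.one_div_le_one_div (α := ℝ) (Nat.zero_le k)
  let l : unitInterval := ⟨1 - 1 / ((k : ℝ) + 1), by linarith, by linarith⟩
  have hgle : g ≤ nOplus f (k + 1) ⊔ const l := by
    intro x
    rcases hk (Set.mem_univ x) with hx | hx
    · refine le_trans ?_ (le_sup_left : nOplus f (k + 1) x ≤ nOplus f (k + 1) x ⊔ l)
      rw [nOplus_apply]
      refine (show g x ≤ 1 from le_top).trans (Subtype.coe_le_coe.1 ?_)
      rw [coe_nOplus, Set.Icc.coe_one]
      refine le_min ?_ le_rfl
      have hx : 1 / ((k : ℝ) + 1) < f x := hx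
      rw [div_lt_iff₀ (by positivity)] at hx
      push_cast
      linarith
    · exact le_trans (Subtype.coe_le_coe.1 (show (g x : ℝ) ≤ l from le_of_lt hx))
        (le_sup_right : l ≤ nOplus f (k + 1) x ⊔ l)
  have h₁ := v.mono hgle
  have h₂ : v (nOplus f (k + 1) ⊔ const l) = v (nOplus f (k + 1)) ⊔ l :=
    (v.map_sup _ _).trans (congrArg _ (v.map_const l))
  rw [h₂, apply_nOplus, hf, hg, nOplus_zero_unitInterval] at h₁
  have h₃ : (1 : ℝ) ≤ max 0 (l : ℝ) := h₁
  have h₄ : (l : ℝ) = 1 - 1 / ((k : ℝ) + 1) := rfl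
  rcases le_max_iff.1 h₃ with h | h <;> linarith

theorem evalPoint_surjective [Preorder X] :
    Function.Surjective (evalPoint : X → MCHom (X →Co unitInterval) unitInterval) := by
  intro v
  -- The sets `{f = 0} ∩ {g = 1}` with `v f = 0` and `v g = 1` are a directed family of nonempty
  -- compact sets; the points of the intersection are those at which `v` is the evaluation.
  let ι := {p : (X →Co unitInterval) × (X →Co unitInterval) // v p.1 = 0 ∧ v p.2 = 1}
  let Z : ι → Set X := fun p => {x | p.1.1 x = 0} ∩ {x | p.1.2 x = 1}
  have hZ : ∀ p, IsClosed (Z p) := fun p =>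
    (isClosed_eq p.1.1.continuous_toFun continuous_const).inter
      (isClosed_eq p.1.2.continuous_toFun continuous_const)
  have : Nonempty ι := ⟨⟨(const 0, const 1), v.map_const 0, v.map_const 1⟩⟩
  have hdir : Directed (· ⊇ ·) Z := by
    rintro ⟨⟨f, g⟩, hf, hg⟩ ⟨⟨f', g'⟩, hf', hg'⟩
    refine ⟨⟨(f ⊔ f', g ⊓ g'), ?_, ?_⟩, ?_, ?_⟩
    · exact (v.map_sup f f').trans (by
        change v f ⊔ v f' = 0
        rw [show v f = 0 from hf, show v f' = 0 from hf', sup_idem])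
    · exact (v.map_inf g g').trans (by
        change v g ⊓ v g' = 1
        rw [show v g = 1 from hg, show v g' = 1 from hg', inf_idem])
    all_goals
      rintro x ⟨hx₁, hx₂⟩
      have h₁ : f x ⊔ f' x = 0 := hx₁
      have h₂ : g x ⊓ g' x = 1 := hx₂
    · exact ⟨le_bot_iff.1 (le_sup_left.trans_eq h₁), top_le_iff.1 (h₂.ge.trans inf_le_left)⟩
    · exact ⟨le_bot_iff.1 (le_sup_right.trans_eq h₁), top_le_iff.1 (h₂.ge.trans inf_le_right)⟩
  obtain ⟨x, hx⟩ := IsCompact.nonempty_iInter_of_directed_nonempty_isCompact_isClosed Z hdir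
    (fun p => exists_apply_eq_zero_and_one v p.2.1 p.2.2) (fun p => (hZ p).isCompact) hZ
  refine ⟨x, DFunLike.ext _ _ fun f => ?_⟩
  change f x = v f
  have hf₀ : v (f ⊙ₘ const (unitInterval.symm (v f))) = 0 := by
    rw [apply_odot_const]
    exact Subtype.ext (by
      rw [coe_odot, unitInterval.coe_symm_eq, Set.Icc.coe_zero]
      exact max_eq_right (by linarith))
  have hf₁ : v (f ⊕ₘ const (unitInterval.symm (v f))) = 1 := by
    rw [apply_oplus_const]
    exact Subtype.ext (by
      rw [coe_oplus, unitInterval.coe_symm_eq, Set.Icc.coe_one]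
      exact min_eq_right (by linarith))
  obtain ⟨h₀, h₁⟩ := Set.mem_iInter.1 hx ⟨(_, _), hf₀, hf₁⟩
  have h₀ : f x ⊙ₘ unitInterval.symm (v f) = 0 := h₀
  have h₁ : f x ⊕ₘ unitInterval.symm (v f) = 1 := h₁
  rw [Subtype.ext_iff, coe_odot, unitInterval.coe_symm_eq, Set.Icc.coe_zero] at h₀
  rw [Subtype.ext_iff, coe_oplus, unitInterval.coe_symm_eq, Set.Icc.coe_one] at h₁
  exact Subtype.ext (le_antisymm (by linarith [max_eq_right_iff.1 h₀])
    (by linarith [min_eq_right_iff.1 h₁]))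

theorem evalPoint_le_evalPoint_iff [PartialOrder X] [OrderClosedTopology X] {x y : X} :
    evalPoint x ≤ evalPoint y ↔ x ≤ y := by
  refine ⟨fun h => ?_, fun h f => f.monotone' h⟩
  by_contra hxy
  obtain ⟨f, hf⟩ := exists_apply_lt_of_not_le hxy
  exact hf.not_ge (h f)

end EvalPoint

/-! ### Completeness of the algebra of monotone continuous functions -/

theorem isArchimedean_hom {X : Type u} [TopologicalSpace X] [Preorder X] :
    IsArchimedean (X →Co unitInterval) := fun f g h =>
  DFunLike.ext _ _ fun x => Subtype.ext (sub_eq_zero.1 (abs_nonpos_iff.1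
    ((abs_apply_sub_apply_le (evalPoint x) f g).trans_eq h)))

section Complete

variable {X : Type u} [TopologicalSpace X] [CompactSpace X]

theorem mcDist_le_of_forall_apply [Preorder X] {f g : X →Co unitInterval} {δ : ℝ} (hδ : 0 ≤ δ)
    (h : ∀ x, |(f x : ℝ) - g x| ≤ δ) : mcDist f g ≤ δ :=
  mcDist_le_of_forall hδ fun v => by
    obtain ⟨x, rfl⟩ := evalPoint_surjective v
    exact h x

theorem isCauchyComplete_hom [Preorder X] : IsCauchyComplete (X →Co unitInterval) := by
  intro f hf
  have hdist : ∀ n m x, dist (f n x) (f m x) ≤ mcDist (f n) (f m) := fun n m x =>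
    abs_apply_sub_apply_le (evalPoint x) (f n) (f m)
  have hcauchy : UniformCauchySeqOn (fun n x => f n x) Filter.atTop Set.univ :=
    Metric.uniformCauchySeqOn_iff.2 fun ε hε => (hf ε hε).imp fun k hk n hn m hm x _ =>
      (hdist n m x).trans_lt (hk n m hn hm)
  choose F hF using fun x => cauchySeq_tendsto_of_complete (hcauchy.cauchySeq (Set.mem_univ x))
  have hunif : TendstoUniformly (fun n x => f n x) F Filter.atTop :=
    tendstoUniformlyOn_univ.1 (hcauchy.tendstoUniformlyOn_of_tendsto fun x _ => hF x)
  refine ⟨⟨⟨F, fun x y hxy => le_of_tendsto_of_tendsto' (hF x) (hF y)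
    fun n => (f n).monotone' hxy⟩, hunif.continuous
      (Filter.Frequently.of_forall fun n => (f n).continuous_toFun)⟩, fun ε hε => ?_⟩
  obtain ⟨n, hn⟩ := Filter.eventually_atTop.1
    (Metric.tendstoUniformly_iff.1 hunif (ε / 2) (half_pos hε))
  refine ⟨n, fun m hm => (mcDist_le_of_forall_apply (half_pos hε).le fun x => ?_).trans_lt
    (half_lt_self hε)⟩
  have := hn m hm x
  rw [dist_comm] at this
  exact this.le

end Complete

/-! ### The duality -/

theorem isArchimedeanCauchyComplete_C (X : PosComp.{u}) :
    IsArchimedeanCauchyComplete (C.obj (op X.obj)) :=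
  have : CompactSpace X.obj := X.property.1
  ⟨isArchimedean_hom, isCauchyComplete_hom⟩

theorem isIso_of_bijective_MC {A B : MC.{u}} (f : MCHom A B) (hf : Function.Bijective f) :
    IsIso (C := MC.{u}) (X := A) (Y := B) f := by
  let e := Equiv.ofBijective f hf
  have he : ∀ b, f (e.symm b) = b := e.apply_symm_apply
  have he' : ∀ a, e.symm (f a) = a := e.symm_apply_apply
  refine ⟨⟨(⟨e.symm, fun a b => hf.1 ?_, fun a b => hf.1 ?_, fun a b => hf.1 ?_,
    fun a b => hf.1 ?_, fun l => hf.1 ?_⟩ : MCHom B A), MCHom.ext (funext he'),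
    MCHom.ext (funext he)⟩⟩
  · exact (he _).trans ((f.map_sup _ _).trans (congrArg₂ _ (he a) (he b))).symm
  · exact (he _).trans ((f.map_inf _ _).trans (congrArg₂ _ (he a) (he b))).symm
  · exact (he _).trans ((f.map_oplus _ _).trans (congrArg₂ _ (he a) (he b))).symm
  · exact (he _).trans ((f.map_odot _ _).trans (congrArg₂ _ (he a) (he b))).symm
  · exact (he _).trans (f.map_const l).symm

theorem isIso_epsilonUnit (A : ArchimedeanCauchyCompleteMC.{u}) : IsIso (epsilonUnit A.obj) :=
  isIso_of_bijective_MC (epsilonUnit A.obj)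
    ⟨evalElement_injective A.property.1, evalElement_surjective A.property.2⟩

theorem isIso_etaUnit (X : PosComp.{u}) : IsIso (etaUnit X.obj) := by
  obtain ⟨X, hX₁, hX₂, hX₃⟩ := X
  let _ : PartialOrder X := { PreT.pre X with le_antisymm := hX₂ }
  have : OrderClosedTopology X := ⟨hX₃⟩
  have hle : ∀ {x y : X}, evalPoint x ≤ evalPoint y ↔ x ≤ y := evalPoint_le_evalPoint_iff
  have hbij : Function.Bijective (evalPoint : X → MCHom (X →Co unitInterval) unitInterval) :=
    ⟨fun x y hxy => le_antisymm (hle.1 hxy.le) (hle.1 hxy.ge), evalPoint_surjective⟩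
  let e := Equiv.ofBijective _ hbij
  have hcont : Continuous e := (etaUnit X).continuous_toFun
  -- A continuous bijection from a compact space to a Hausdorff space is a homeomorphism.
  have hinv : Continuous e.symm := hcont.continuous_symm_of_equiv_compact_to_t2
  let g : MCHom (X →Co unitInterval) unitInterval →Co X :=
    ⟨⟨e.symm, fun v w hvw => hle.1 (by
      change e (e.symm v) ≤ e (e.symm w)
      rwa [e.apply_symm_apply, e.apply_symm_apply])⟩, hinv⟩
  exact ⟨⟨g, ContinuousOrderHom.ext e.symm_apply_apply,
    ContinuousOrderHom.ext e.apply_symm_apply⟩⟩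

/-- The unit on compact ordered spaces, as a natural isomorphism. -/
noncomputable def etaIso :
    𝟭 PosComp.{u}ᵒᵖ ≅ CRestrict isArchimedeanCauchyComplete_C ⋙
      (MaxRestrict fun A => isCompactOrdered_max A.obj).rightOp :=
  (NatIso.ofComponents
    (fun X => Iso.op (IsCompactOrdered.isoMk (@asIso _ _ _ _ _ (isIso_etaUnit X.unop))))
    fun _ => rfl).symm

/-- The unit on archimedean Cauchy complete algebras, as a natural isomorphism. -/
noncomputable def epsilonIso :
    (MaxRestrict fun A => isCompactOrdered_max A.obj).rightOp ⋙
      CRestrict isArchimedeanCauchyComplete_C ≅ 𝟭 ArchimedeanCauchyCompleteMC.{u} :=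
  (NatIso.ofComponents
    (fun A => IsArchimedeanCauchyComplete.isoMk (@asIso _ _ _ _ _ (isIso_epsilonUnit A)))
    fun _ => rfl).symm

end MCDuality

theorem mainTheorem2 :
    ∃ (hC : ∀ X : MCDuality.PosComp.{u},
          MCDuality.IsArchimedeanCauchyComplete (MCDuality.C.obj (op X.obj)))
      (hM : ∀ A : MCDuality.ArchimedeanCauchyCompleteMC.{u},
          MCDuality.IsCompactOrdered (MCDuality.Max.obj (op A.obj)))
      (e : MCDuality.PosComp.{u}ᵒᵖ ≌ MCDuality.ArchimedeanCauchyCompleteMC.{u}),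
      e.functor = MCDuality.CRestrict hC ∧
      e.inverse = (MCDuality.MaxRestrict hM).rightOp ∧
      (∀ X : MCDuality.PosComp.{u}, IsIso (MCDuality.etaUnit X.obj)) ∧
      (∀ A : MCDuality.ArchimedeanCauchyCompleteMC.{u}, IsIso (MCDuality.epsilonUnit A.obj)) :=
  ⟨MCDuality.isArchimedeanCauchyComplete_C, fun A => MCDuality.isCompactOrdered_max A.obj,
    CategoryTheory.Equivalence.mk _ _ MCDuality.etaIso MCDuality.epsilonIso, rfl, rfl,
    MCDuality.isIso_etaUnit, MCDuality.isIso_epsilonUnit⟩
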